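/- Let $A=\{1,x,x'\}$ (its elements are called anchors) with the involution $1'=1$, $(x)'=x'$, $(x')'=x$. For a 5-tuple $g$ write $g=(g^l,g^{la},g^c,g^{ra},g^r)$. Define sets $G_{i,e},G_{i,d}$ and $G_i=G_{i,e}\cup G_{i,d}$ recursively. Put $G_0=G_{0,e}=\{1\}$, $G_{1,e}=\{g_{xx'}\}$ with $g_{xx'}=(1,1,x,x',1)$, and, for $i\ge 2$, $$G_{i,e}=\{(g,(g^{la})',g^l,(g^{ra})',g),\ (g,(g^{ra})',g^l,(g^{la})',g) : g\in G_{i-1,e}\}.$$ Put $G_{0,d}=G_{1,d}=G_{2,d}=\emptyset$ and, for $i\ge 3$, let $G_{i,d}$ be the set of all $g\in G_{i-1}\times A\times G_{i-2}\times A\times G_{i-1}$ such that - $g^l\ne g^r$; - with $k=g^l$, $(g^c,g^{la})$ is $(k^l,(k^{la})')$ or $(k^r,(k^{ra})')$; - with $k=g^r$, $(g^c,g^{ra})$ is $(k^l,(k^{la})')$ or $(k^r,(k^{ra})')$. Elements of $G_i$ are said to have height $i$. Let $G=A\cup\bigcup_{i\ge1}G_i$. Let $F^1=G^+/\rho$,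 where $G^+$ is the free semigroup on $G$ and $\rho$ is the smallest congruence on $G^+$ containing the following pairs: - $(xx'x,x)$, $(x'xx',x')$ and $(g_{xx'},xx')$; - $(1g,g)$ and $(g1,g)$ for all $g\in G$; - $(gg,g)$ for all $g\in\bigcup_{i\ge0}G_i$; - for all $g\in G_i$ with $i\ge2$, writing $g^L=(g^{la})'g^lg^{la}$ and $g^R=(g^{ra})'g^rg^{ra}$: $(g^cg^Lg,\,g)$, $(gg^Rg^c,\,g)$ and $(g^rg^{ra}g(g^{la})'g^l,\ g^rg^{ra}g^c(g^{la})'g^l)$. Thus $F^1$ is a monoid with identity $[1]$. Write $[u]$ for the $\rho$-class of $u\in G^+$. Let $\mathcal R$, $\mathcal L$ and $\mathcal D=\mathcal L\vee\mathcal R$ be Green's relations on $F^1$. **Theorem.** Let $n\ge1$ and $g\in G_n$. Then the $\mathcal R$-class and the $\mathcal L$-class of $[g]$ in $F^1$ each have exactly $2^n$ elements, and the $\mathcal D$-class of $[g]$ has exactly $2^{2n}$ elements. Moreover, this $\mathcal D$-class contains exactly $2^n$ $\mathcal R$-classes and exactly $2^n$ $\mathcal L$-classes. -/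

import Mathlib

/-! ### Green's relations on an arbitrary semigroup -/

namespace Green

variable {S : Type*} [Semigroup S]

/-- The principal right ideal `s S¹`. -/
def rightIdeal (s : S) : Set S := {t | t = s ∨ ∃ u, t = s * u}

/-- The principal left ideal `S¹ s`. -/
def leftIdeal (s : S) : Set S := {t | t = s ∨ ∃ u, t = u * s}

/-- Green's relation `𝓡`: mutual inclusion of the principal right ideals. -/
def R (S : Type*) [Semigroup S] : Setoid S where
  r s t := rightIdeal s ⊆ rightIdeal t ∧ rightIdeal t ⊆ rightIdeal s
  iseqv := ⟨fun _ => ⟨subset_rfl, subset_rfl⟩, fun h => ⟨h.2, h.1⟩,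
    fun h k => ⟨h.1.trans k.1, k.2.trans h.2⟩⟩

/-- Green's relation `𝓛`: mutual inclusion of the principal left ideals. -/
def L (S : Type*) [Semigroup S] : Setoid S where
  r s t := leftIdeal s ⊆ leftIdeal t ∧ leftIdeal t ⊆ leftIdeal s
  iseqv := ⟨fun _ => ⟨subset_rfl, subset_rfl⟩, fun h => ⟨h.2, h.1⟩,
    fun h k => ⟨h.1.trans k.1, k.2.trans h.2⟩⟩

/-- Green's relation `𝓓`: the join of `𝓛` and `𝓡` among the equivalence relations. -/
def D (S : Type*) [Semigroup S] : Setoid S := L S ⊔ R S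

/-- The class of `s` for an equivalence relation `K`. -/
def cls (K : Setoid S) (s : S) : Set S := {t | K t s}

end Green

namespace WeakGen

/-! ### Anchors and 5-tuples -/

/-- The anchors `1`, `x`, `x'`. -/
inductive Anchor
  | one
  | x
  | x'

/-- The involution `1' = 1`, `(x)' = x'`, `(x')' = x` on anchors. -/
def Anchor.inv : Anchor → Anchor
  | one => one
  | x => x'
  | x' => x

/-- Formal terms: anchors and iterated 5-tuples `(l, la, c, ra, r)`; the generators are singled
out among them below. -/
inductive Term
  | anchor (a : Anchor)
  | tuple (l : Term) (la : Anchor) (c : Term) (ra : Anchor) (r : Term)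

namespace Term

/-- The letter `1`. -/
def one : Term := anchor Anchor.one

/-! The entries of a 5-tuple. The values at anchors are never used: every application is to a
5-tuple. -/

/-- left entry -/
def l : Term → Term
  | anchor _ => one
  | tuple l _ _ _ _ => l

/-- left anchor -/
def la : Term → Anchor
  | anchor _ => Anchor.one
  | tuple _ la _ _ _ => la

/-- middle entry -/
def c : Term → Term
  | anchor _ => one
  | tuple _ _ c _ _ => c

/-- right anchor -/
def ra : Term → Anchor
  | anchor _ => Anchor.one
  | tuple _ _ _ ra _ => ra

/-- right entry -/
def r : Term → Term
  | anchor _ => one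
  | tuple _ _ _ _ r => r

end Term

/-- The 5-tuple `(1, 1, x, x', 1)`, which represents `x x'`. -/
def gxx : Term := .tuple .one .one (.anchor .x) .x' .one

/-- The sets `G_{i,e}`, with the convention `G_{0,e} = {1}`. -/
def Ge : ℕ → Set Term
  | 0 => {Term.one}
  | 1 => {gxx}
  | i + 2 => {h | ∃ g ∈ Ge (i + 1),
      h = .tuple g g.la.inv g.l g.ra.inv g ∨ h = .tuple g g.ra.inv g.l g.la.inv g}

/-- The sets `G_{i,d}`; they are empty for `i ≤ 2`. -/
def Gd : ℕ → Set Term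
  | 0 => ∅
  | 1 => ∅
  | 2 => ∅
  | i + 3 => {h | ∃ (l : Term) (la : Anchor) (c : Term) (ra : Anchor) (r : Term),
      h = .tuple l la c ra r ∧
      l ∈ Ge (i + 2) ∪ Gd (i + 2) ∧ c ∈ Ge (i + 1) ∪ Gd (i + 1) ∧ r ∈ Ge (i + 2) ∪ Gd (i + 2) ∧
      l ≠ r ∧
      ((c, la) = (l.l, l.la.inv) ∨ (c, la) = (l.r, l.ra.inv)) ∧
      ((c, ra) = (r.l, r.la.inv) ∨ (c, ra) = (r.r, r.ra.inv))}

/-- `G_i = G_{i,e} ∪ G_{i,d}`; for `i ≥ 1` these are the 5-tuples of height `i`, and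
`G_0 = {1}`. -/
def G (i : ℕ) : Set Term := Ge i ∪ Gd i

/-- The generators: the anchors `1, x, x'` and the 5-tuples of all `G_i` with `i ≥ 1`. -/
def IsGen (t : Term) : Prop := (∃ a, t = .anchor a) ∨ ∃ i, 1 ≤ i ∧ t ∈ G i

theorem isGen_one : IsGen Term.one := Or.inl ⟨_, rfl⟩

theorem isGen_of_mem {i : ℕ} {t : Term} (h : t ∈ G i) : IsGen t := by
  rcases i with _ | i
  · rcases h with h | h
    · exact Or.inl ⟨Anchor.one, h⟩
    · exact h.elim
  · exact Or.inr ⟨i + 1, by omega, h⟩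

/-- The entries of a 5-tuple of height at least `2`: `g^l, g^r ∈ G_{i-1}` and `g^c ∈ G_{i-2}`. -/
theorem entries_mem {i : ℕ} {t : Term} (h : t ∈ G (i + 2)) :
    t.l ∈ G (i + 1) ∧ t.c ∈ G i ∧ t.r ∈ G (i + 1) := by
  rcases h with h | h
  · obtain ⟨g, hg, h⟩ := h
    have hl : g.l ∈ G i := by
      rcases i with _ | i
      · cases hg
        exact Or.inl rfl
      · obtain ⟨k, hk, h | h⟩ := hg <;> subst h <;> exact Or.inl hk
    rcases h with h | h <;> subst h <;> exact ⟨Or.inl hg, hl, Or.inl hg⟩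
  · rcases i with _ | i
    · exact h.elim
    · obtain ⟨l, la, c, ra, r, rfl, hl, hc, hr, -⟩ := h
      exact ⟨hl, hc, hr⟩

theorem isGen_entries {t : Term} (h : IsGen t) : IsGen t.l ∧ IsGen t.c ∧ IsGen t.r := by
  rcases h with ⟨a, rfl⟩ | ⟨i, hi, h⟩
  · exact ⟨isGen_one, isGen_one, isGen_one⟩
  · rcases i with _ | _ | i
    · omega
    · rcases h with h | h
      · cases h
        exact ⟨isGen_one, Or.inl ⟨Anchor.x, rfl⟩, isGen_one⟩
      · exact h.elim
    · obtain ⟨h1, h2, h3⟩ := entries_mem h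
      exact ⟨isGen_of_mem h1, isGen_of_mem h2, isGen_of_mem h3⟩

/-- The generating set, as a type. -/
def Gen : Type := {t : Term // IsGen t}

namespace Gen

/-- The generator given by an anchor. -/
def anchor (a : Anchor) : Gen := ⟨.anchor a, Or.inl ⟨a, rfl⟩⟩

/-- The generator given by an element of some `G_i`. -/
def ofMem {i : ℕ} {t : Term} (h : t ∈ G i) : Gen := ⟨t, isGen_of_mem h⟩

/-- left entry -/
def l (g : Gen) : Gen := ⟨g.1.l, (isGen_entries g.2).1⟩

/-- middle entry -/
def c (g : Gen) : Gen := ⟨g.1.c, (isGen_entries g.2).2.1⟩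

/-- right entry -/
def r (g : Gen) : Gen := ⟨g.1.r, (isGen_entries g.2).2.2⟩

end Gen

/-! ### The presentation -/

/-- Words: the free semigroup on the generators. -/
abbrev Word : Type := FreeSemigroup Gen

/-- The one-letter word of a generator. -/
def letter (g : Gen) : Word := FreeSemigroup.of g

/-- The one-letter word of an anchor. -/
def anc (a : Anchor) : Word := letter (Gen.anchor a)

/-- The word `g^L = (g^{la})' g^l g^{la}`. -/
def wordL (g : Gen) : Word := anc g.1.la.inv * letter g.l * anc g.1.la

/-- The word `g^R = (g^{ra})' g^r g^{ra}`. -/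
def wordR (g : Gen) : Word := anc g.1.ra.inv * letter g.r * anc g.1.ra

theorem gxx_mem : gxx ∈ G 1 := Or.inl rfl

/-- The defining relations. -/
inductive Rel : Word → Word → Prop
  | x_reg : Rel (anc .x * anc .x' * anc .x) (anc .x)
  | x'_reg : Rel (anc .x' * anc .x * anc .x') (anc .x')
  | gxx_eq : Rel (letter (Gen.ofMem gxx_mem)) (anc .x * anc .x')
  | one_left (g : Gen) : Rel (anc .one * letter g) (letter g)
  | one_right (g : Gen) : Rel (letter g * anc .one) (letter g)
  | idem (i : ℕ) (g : Gen) (hg : g.1 ∈ G i) : Rel (letter g * letter g) (letter g)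
  | sandwich_left (i : ℕ) (hi : 2 ≤ i) (g : Gen) (hg : g.1 ∈ G i) :
      Rel (letter g.c * wordL g * letter g) (letter g)
  | sandwich_right (i : ℕ) (hi : 2 ≤ i) (g : Gen) (hg : g.1 ∈ G i) :
      Rel (letter g * wordR g * letter g.c) (letter g)
  | sandwich_mid (i : ℕ) (hi : 2 ≤ i) (g : Gen) (hg : g.1 ∈ G i) :
      Rel (letter g.r * anc g.1.ra * letter g * anc g.1.la.inv * letter g.l)
        (letter g.r * anc g.1.ra * letter g.c * anc g.1.la.inv * letter g.l)

/-- The monoid `F¹`, the quotient of the free semigroup on the generators by the smallest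
congruence containing the defining relations. -/
abbrev F1 : Type := (conGen Rel).Quotient

/-- The class `[u]` of a word. -/
def mk (u : Word) : F1 := (conGen Rel).toQuotient u

end WeakGen

/-! Every 5-tuple has a left and a right edge down to its entries, which are one lower, labelled by
its anchors. As the two sides are kept apart even when the entries coincide, there are exactly `2 ^
n` descending paths from a `g` of height `n` to `1`. A path `g, u₁, u₂, …` is read in `F1` as the
product `g a₁' u₁ a₂' u₂ ⋯` (`path`), and the `𝓡`-class of `[g]` consists of these products.

To multiply a path by a letter `k`, follow it by a canonical ascent from `1` to `k` and a canonical
descent back to `1`. A rise to `u` after a descent from `v` to `c` either undoes that descent or, by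
the third relation for tuples, may pass through the join of `u` and `v` over `c`: the valley is
filled. Repetition moves the rise towards the front until it cancels a descent; if it would have to
climb above `g`, the result is a zero, `none`. This respects all relations (`run_rel`), so `F1` acts
on paths with zero, and as long as the result is not zero the action computes products in `F1`
(`path_mul_of_act`).

The element `[g]` fixes its canonical path, so an element `[g]u` in its `𝓡`-class cannot send that
path to zero and is itself a path. Conversely each descent can be undone (`gen_child_gen`), so every
path lies in the `𝓡`-class; and the element of a path `p` carries the canonical path to `p`
(`act_path_full`), so distinct paths to `1` give distinct elements. If `p` is also `𝓛`-related to
`[g]`, then `p[g] = p`, whereas `[g]` sends every path to the canonical one or to zero; hence the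
`𝓗`-class of `[g]` is trivial (`eq_gen_of_H`). Reversal of words with `x ↔ x'` and left ↔ right
gives the count for `𝓛`. Finally, for an idempotent with trivial `𝓗`-class, multiplication is a
bijection from `𝓛`-class times `𝓡`-class onto the `𝓓`-class (`ncard_cls_D`). -/

namespace Green

/-! ### The `𝓓`-class of an idempotent with trivial `𝓗`-class -/

variable {S : Type*} [Semigroup S]

omit [Semigroup S] in
theorem mem_cls {K : Setoid S} {s t : S} : t ∈ cls K s ↔ K s t := K.comm'

theorem R_iff {o : S} (ho : ∀ a : S, a * o = a) {s t : S} :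
    R S s t ↔ (∃ u, s = t * u) ∧ ∃ v, t = s * v := by
  have h : ∀ s t : S, rightIdeal s ⊆ rightIdeal t ↔ ∃ u, s = t * u := by
    refine fun s t => ⟨fun h => ?_, ?_⟩
    · rcases h (Or.inl rfl) with rfl | h
      · exact ⟨o, (ho s).symm⟩
      · exact h
    · rintro ⟨u, rfl⟩ a (rfl | ⟨v, rfl⟩)
      · exact Or.inr ⟨u, rfl⟩
      · exact Or.inr ⟨u * v, mul_assoc t u v⟩
  exact and_congr (h s t) (h t s)

theorem L_iff {o : S} (ho : ∀ a : S, o * a = a) {s t : S} :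
    L S s t ↔ (∃ u, s = u * t) ∧ ∃ v, t = v * s := by
  have h : ∀ s t : S, leftIdeal s ⊆ leftIdeal t ↔ ∃ u, s = u * t := by
    refine fun s t => ⟨fun h => ?_, ?_⟩
    · rcases h (Or.inl rfl) with rfl | h
      · exact ⟨o, (ho s).symm⟩
      · exact h
    · rintro ⟨u, rfl⟩ a (rfl | ⟨v, rfl⟩)
      · exact Or.inr ⟨u, rfl⟩
      · exact Or.inr ⟨v * u, (mul_assoc v u t).symm⟩
  exact and_congr (h s t) (h t s)

section

variable {o e : S} (ho : ∀ a : S, a * o = a) (ho' : ∀ a : S, o * a = a) (he : e * e = e)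

include he

theorem mul_eq_of_L (ho' : ∀ a : S, o * a = a) {s : S} (h : L S e s) : s * e = s := by
  obtain ⟨-, v, rfl⟩ := (L_iff ho').1 h
  rw [mul_assoc, he]

theorem mul_eq_of_R (ho : ∀ a : S, a * o = a) {s : S} (h : R S e s) : e * s = s := by
  obtain ⟨-, v, rfl⟩ := (R_iff ho).1 h
  rw [← mul_assoc, he]

include ho ho'

/-- The `𝓓`-class of an idempotent is the product of its `𝓛`-class and its `𝓡`-class. -/
theorem cls_D_eq : cls (D S) e = {a | ∃ s, L S e s ∧ ∃ t, R S e t ∧ a = s * t} := by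
  have hR : ∀ a b : S, R S a b → (∃ s, L S e s ∧ ∃ t, R S e t ∧ a = s * t) →
      ∃ s, L S e s ∧ ∃ t, R S e t ∧ b = s * t := by
    rintro _ b hab ⟨s, hs, t, ht, rfl⟩
    obtain ⟨⟨y, hy⟩, z, rfl⟩ := (R_iff ho).1 hab
    refine ⟨s, hs, t * z, (R S).trans' ht ((R_iff ho).2 ⟨⟨y, ?_⟩, z, rfl⟩), mul_assoc s t z⟩
    obtain ⟨⟨v, hv⟩, -⟩ := (L_iff ho').1 hs
    calc t = v * (s * t) := by rw [← mul_assoc, ← hv, mul_eq_of_R he ho ht]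
      _ = v * s * (t * z * y) := by rw [hy]; simp only [mul_assoc]
      _ = t * z * y := by rw [← hv, ← mul_assoc, ← mul_assoc, mul_eq_of_R he ho ht]
  have hL : ∀ a b : S, L S a b → (∃ s, L S e s ∧ ∃ t, R S e t ∧ a = s * t) →
      ∃ s, L S e s ∧ ∃ t, R S e t ∧ b = s * t := by
    rintro _ b hab ⟨s, hs, t, ht, rfl⟩
    obtain ⟨⟨y, hy⟩, z, rfl⟩ := (L_iff ho').1 hab
    refine ⟨z * s, (L S).trans' hs ((L_iff ho').2 ⟨⟨y, ?_⟩, z, rfl⟩), t, ht,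
      (mul_assoc z s t).symm⟩
    obtain ⟨⟨v, hv⟩, -⟩ := (R_iff ho).1 ht
    calc s = (s * t) * v := by rw [mul_assoc, ← hv, mul_eq_of_L he ho' hs]
      _ = y * (z * s) * (t * v) := by rw [hy]; simp only [mul_assoc]
      _ = y * (z * s) := by rw [← hv, mul_assoc, mul_assoc, mul_eq_of_L he ho' hs]
  apply Set.Subset.antisymm
  · intro a ha
    -- `D S` is the least equivalence containing `L S` and `R S`; membership in the product set is
    -- invariant under both, so it is invariant under `D S`.
    let K : Setoid S := ⟨fun a b => (∃ s, L S e s ∧ ∃ t, R S e t ∧ a = s * t) ↔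
      ∃ s, L S e s ∧ ∃ t, R S e t ∧ b = s * t,
      ⟨fun _ => Iff.rfl, Iff.symm, Iff.trans⟩⟩
    have hK : D S ≤ K := sup_le
      (fun {a b} h => ⟨hL a b h, hL b a ((L S).symm' h)⟩)
      (fun {a b} h => ⟨hR a b h, hR b a ((R S).symm' h)⟩)
    exact (hK (mem_cls.1 ha)).1 ⟨e, (L S).refl' e, e, (R S).refl' e, he.symm⟩
  · rintro _ ⟨s, hs, t, ht, rfl⟩
    have h1 : D S e s := (le_sup_left : L S ≤ D S) hs
    refine mem_cls.2 ((D S).trans' h1 ((le_sup_right : R S ≤ D S) ((R_iff ho).2 ?_)))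
    obtain ⟨⟨v, hv⟩, -⟩ := (R_iff ho).1 ht
    exact ⟨⟨v, by rw [mul_assoc, ← hv, mul_eq_of_L he ho' hs]⟩, t, rfl⟩

variable (hH : ∀ h, R S e h → L S e h → h = e)

include hH

/-- If `s' = s z`, then `e z e` lies in the `𝓗`-class of `e`, hence equals `e`, and `s' = s (e z e)
= s`. -/
theorem eq_of_R_of_mem_L {s s' : S} (hs : L S e s) (hs' : L S e s') (h : R S s s') : s = s' := by
  obtain ⟨⟨y, hy⟩, z, hz⟩ := (R_iff ho).1 h
  obtain ⟨⟨v, hv⟩, -⟩ := (L_iff ho').1 hs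
  obtain ⟨⟨v', hv'⟩, -⟩ := (L_iff ho').1 hs'
  have hse := mul_eq_of_L he ho' hs
  have hse' := mul_eq_of_L he ho' hs'
  have h1 : s' = s * (e * z * e) := by rw [← mul_assoc, ← mul_assoc, hse, ← hz, hse']
  have h2 : e * z * e = e := by
    refine hH _ ((R_iff ho).2 ⟨⟨y, ?_⟩, z * e, mul_assoc e z e⟩)
      ((L_iff ho').2 ⟨⟨v' * s, ?_⟩, e * z, rfl⟩)
    · calc e = v * (s * (e * z * e) * y) := by rw [← h1, ← hy, hv]
        _ = (v * s) * (e * z * e) * y := by simp only [mul_assoc]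
        _ = e * z * e * y := by rw [← hv]; simp only [← mul_assoc, he]
    · rw [mul_assoc, ← h1, hv']
  rw [h1, h2, hse]

theorem eq_of_L_of_mem_R {s s' : S} (hs : R S e s) (hs' : R S e s') (h : L S s s') : s = s' := by
  obtain ⟨⟨y, hy⟩, z, hz⟩ := (L_iff ho').1 h
  obtain ⟨⟨v, hv⟩, -⟩ := (R_iff ho).1 hs
  obtain ⟨⟨v', hv'⟩, -⟩ := (R_iff ho).1 hs'
  have hse := mul_eq_of_R he ho hs
  have hse' := mul_eq_of_R he ho hs'
  have h1 : s' = e * z * e * s := by rw [mul_assoc, hse, mul_assoc, ← hz, hse']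
  have h2 : e * z * e = e := by
    refine hH _ ((R_iff ho).2 ⟨⟨s * v', ?_⟩, z * e, mul_assoc e z e⟩)
      ((L_iff ho').2 ⟨⟨y, ?_⟩, e * z, rfl⟩)
    · rw [← mul_assoc, ← h1, hv']
    · calc e = y * (e * z * e * s) * v := by rw [← h1, ← hy, hv]
        _ = y * (e * z * e) * (s * v) := by simp only [mul_assoc]
        _ = y * (e * z * e) := by rw [← hv]; simp only [mul_assoc, he]
  rw [h1, h2, hse]

/-- Since `s 𝓡 st 𝓛 t` for `s 𝓛 e 𝓡 t`, the product determines the `𝓡`-class of `s` and the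
`𝓛`-class of `t`, and with trivial `𝓗` these determine `s` and `t`. -/
theorem ncard_cls_D :
    (cls (D S) e).ncard = (cls (L S) e).ncard * (cls (R S) e).ncard := by
  have himg : cls (D S) e = (fun x : S × S => x.1 * x.2) '' (cls (L S) e ×ˢ cls (R S) e) := by
    rw [cls_D_eq ho ho' he]
    ext a
    constructor
    · rintro ⟨s, hs, t, ht, rfl⟩
      exact ⟨(s, t), ⟨mem_cls.2 hs, mem_cls.2 ht⟩, rfl⟩
    · rintro ⟨⟨s, t⟩, ⟨hs, ht⟩, rfl⟩
      exact ⟨s, mem_cls.1 hs, t, mem_cls.1 ht, rfl⟩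
  rw [himg, Set.InjOn.ncard_image, Set.ncard_prod]
  have hRst : ∀ {s t : S}, L S e s → R S e t → R S s (s * t) := fun {s t} hs ht => by
    obtain ⟨⟨v, hv⟩, -⟩ := (R_iff ho).1 ht
    exact (R_iff ho).2 ⟨⟨v, by rw [mul_assoc, ← hv, mul_eq_of_L he ho' hs]⟩, t, rfl⟩
  have hLst : ∀ {s t : S}, L S e s → R S e t → L S t (s * t) := fun {s t} hs ht => by
    obtain ⟨⟨v, hv⟩, -⟩ := (L_iff ho').1 hs
    exact (L_iff ho').2 ⟨⟨v, by rw [← mul_assoc, ← hv, mul_eq_of_R he ho ht]⟩, s, rfl⟩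
  rintro ⟨s, t⟩ ⟨hs, ht⟩ ⟨s', t'⟩ ⟨hs', ht'⟩ h
  rw [mem_cls] at hs ht hs' ht'
  dsimp only at hs ht hs' ht' h
  refine Prod.ext (eq_of_R_of_mem_L ho ho' he hH hs hs' ?_)
    (eq_of_L_of_mem_R ho ho' he hH ht ht' ?_)
  · exact (R S).trans' (hRst hs ht) (h ▸ (R S).symm' (hRst hs' ht'))
  · exact (L S).trans' (hLst hs ht) (h ▸ (L S).symm' (hLst hs' ht'))

/-- Each `𝓡`-class inside the `𝓓`-class meets the `𝓛`-class of `e` in exactly one point. -/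
theorem ncard_R_classes :
    {C : Set S | C ⊆ cls (D S) e ∧ ∃ b, C = cls (R S) b}.ncard = (cls (L S) e).ncard := by
  have himg : {C : Set S | C ⊆ cls (D S) e ∧ ∃ b, C = cls (R S) b} =
      cls (R S) '' cls (L S) e := by
    ext C
    constructor
    · rintro ⟨hC, b, rfl⟩
      have hb := hC (mem_cls.2 ((R S).refl' b))
      rw [cls_D_eq ho ho' he] at hb
      obtain ⟨s, hs, t, ht, rfl⟩ := hb
      refine ⟨s, mem_cls.2 hs, ?_⟩
      have h : R S s (s * t) := by
        obtain ⟨⟨v, hv⟩, -⟩ := (R_iff ho).1 ht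
        exact (R_iff ho).2 ⟨⟨v, by rw [mul_assoc, ← hv, mul_eq_of_L he ho' hs]⟩, t, rfl⟩
      ext x
      rw [mem_cls, mem_cls]
      exact ⟨fun hx => (R S).trans' ((R S).symm' h) hx, fun hx => (R S).trans' h hx⟩
    · rintro ⟨s, hs, rfl⟩
      exact ⟨fun x hx => mem_cls.2 <| (D S).trans' ((le_sup_left : L S ≤ D S) (mem_cls.1 hs))
        ((le_sup_right : R S ≤ D S) (mem_cls.1 hx)), s, rfl⟩
  rw [himg, Set.InjOn.ncard_image]
  intro s hs s' hs' h
  refine eq_of_R_of_mem_L ho ho' he hH (mem_cls.1 hs) (mem_cls.1 hs') ?_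
  rw [← mem_cls, h, mem_cls]

theorem ncard_L_classes :
    {C : Set S | C ⊆ cls (D S) e ∧ ∃ b, C = cls (L S) b}.ncard = (cls (R S) e).ncard := by
  have himg : {C : Set S | C ⊆ cls (D S) e ∧ ∃ b, C = cls (L S) b} =
      cls (L S) '' cls (R S) e := by
    ext C
    constructor
    · rintro ⟨hC, b, rfl⟩
      have hb := hC (mem_cls.2 ((L S).refl' b))
      rw [cls_D_eq ho ho' he] at hb
      obtain ⟨s, hs, t, ht, rfl⟩ := hb
      refine ⟨t, mem_cls.2 ht, ?_⟩
      have h : L S t (s * t) := by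
        obtain ⟨⟨v, hv⟩, -⟩ := (L_iff ho').1 hs
        exact (L_iff ho').2 ⟨⟨v, by rw [← mul_assoc, ← hv, mul_eq_of_R he ho ht]⟩, s, rfl⟩
      ext x
      rw [mem_cls, mem_cls]
      exact ⟨fun hx => (L S).trans' ((L S).symm' h) hx, fun hx => (L S).trans' h hx⟩
    · rintro ⟨s, hs, rfl⟩
      exact ⟨fun x hx => mem_cls.2 <| (D S).trans' ((le_sup_right : R S ≤ D S) (mem_cls.1 hs))
        ((le_sup_left : L S ≤ D S) (mem_cls.1 hx)), s, rfl⟩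
  rw [himg, Set.InjOn.ncard_image]
  intro s hs s' hs' h
  refine eq_of_L_of_mem_R ho ho' he hH (mem_cls.1 hs) (mem_cls.1 hs') ?_
  rw [← mem_cls, h, mem_cls]

end
end Green

/-! ### Tuples of height at least two as joins -/

namespace WeakGen

theorem Anchor.inv_inv (a : Anchor) : a.inv.inv = a := by cases a <;> rfl

theorem Anchor.inv_injective : Function.Injective Anchor.inv :=
  Function.LeftInverse.injective Anchor.inv_inv

namespace Term

/-- The left (`false`) or right (`true`) entry of a 5-tuple. -/
def child (u : Term) : Bool → Term
  | false => u.l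
  | true => u.r

/-- The anchor of the left (`false`) or right (`true`) entry of a 5-tuple. -/
def childAnchor (u : Term) : Bool → Anchor
  | false => u.la
  | true => u.ra

/-- The 5-tuple with left entry `l` and right entry `r` whose middle entry is the child of `l`
on the side `s`, reached from `r` on the side `t`. -/
def join (l : Term) (s : Bool) (r : Term) (t : Bool) : Term :=
  tuple l (l.childAnchor s).inv (l.child s) (r.childAnchor t).inv r

end Term

open Term

theorem mem_G_zero {t : Term} : t ∈ G 0 ↔ t = one := by simp [G, Ge, Gd]

theorem mem_G_one {t : Term} : t ∈ G 1 ↔ t = gxx := by simp [G, Ge, Gd]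

theorem l_eq_r_of_mem_Ge {i : ℕ} {t : Term} (h : t ∈ Ge (i + 1)) : t.l = t.r ∧ t.la ≠ t.ra := by
  induction i generalizing t with
  | zero => cases h; exact ⟨rfl, by simp [gxx, Term.la, Term.ra]⟩
  | succ i ih =>
    obtain ⟨g, hg, rfl | rfl⟩ := h
    · exact ⟨rfl, fun h => (ih hg).2 (Anchor.inv_injective h)⟩
    · exact ⟨rfl, fun h => (ih hg).2 (Anchor.inv_injective h).symm⟩

theorem l_ne_r_of_mem_Gd {i : ℕ} {t : Term} (h : t ∈ Gd i) : t.l ≠ t.r := by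
  match i, h with
  | i + 3, h =>
    obtain ⟨l, la, c, ra, r, rfl, -, -, -, h, -⟩ := h
    exact h

/-- In `Ge` the entries agree and the anchors differ; in `Gd` the entries differ. So an entry
together with its anchor determines the side. -/
theorem child_ne_of_mem {i : ℕ} {t : Term} (h : t ∈ G (i + 1)) :
    (t.l, t.la) ≠ (t.r, t.ra) := by
  intro he
  rw [Prod.mk.injEq] at he
  rcases h with h | h
  · exact (l_eq_r_of_mem_Ge h).2 he.2
  · exact l_ne_r_of_mem_Gd h he.1

theorem side_unique {i : ℕ} {u : Term} (h : u ∈ G (i + 1)) {s t : Bool}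
    (hc : u.child s = u.child t) (ha : u.childAnchor s = u.childAnchor t) : s = t := by
  have := child_ne_of_mem h
  cases s <;> cases t <;> simp_all [child, childAnchor]

theorem child_mem {i : ℕ} {u : Term} (h : u ∈ G (i + 1)) (s : Bool) : u.child s ∈ G i := by
  rcases i with _ | i
  · rw [mem_G_one.1 h, mem_G_zero]
    cases s <;> rfl
  · cases s
    · exact (entries_mem h).1
    · exact (entries_mem h).2.2

/-- This treats both kinds of tuples alike: if `l = r`, two different sides with the same child
force `l ∈ Ge`; otherwise the join belongs to `Gd`. Filling a valley therefore always yields a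
generator. -/
theorem join_mem {i : ℕ} {l r : Term} {s t : Bool} (hl : l ∈ G (i + 1)) (hr : r ∈ G (i + 1))
    (hc : l.child s = r.child t) (hne : l = r → s ≠ t) : join l s r t ∈ G (i + 2) := by
  by_cases h : l = r
  · subst h
    have hs := hne rfl
    have hlr : l.l = l.r := by cases s <;> cases t <;> simp_all [child]
    have he : l ∈ Ge (i + 1) := hl.resolve_right fun h => l_ne_r_of_mem_Gd h hlr
    left
    refine ⟨l, he, ?_⟩
    cases s <;> cases t <;> simp_all [join, child, childAnchor]
  · rcases i with _ | i
    · exact absurd ((mem_G_one.1 hl).trans (mem_G_one.1 hr).symm) h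
    · right
      refine ⟨l, _, _, _, r, rfl, hl, child_mem hl s, hr, h, ?_, ?_⟩
      · cases s <;> simp [child, childAnchor]
      · rw [hc]; cases t <;> simp [child, childAnchor]

theorem exists_join {i : ℕ} {u : Term} (h : u ∈ G (i + 2)) :
    ∃ l s r t, u = join l s r t ∧ l ∈ G (i + 1) ∧ r ∈ G (i + 1) ∧ l.child s = r.child t ∧
      (l = r → s ≠ t) := by
  rcases h with h | h
  · obtain ⟨g, hg, h⟩ := h
    have hlr := (l_eq_r_of_mem_Ge hg).1
    rcases h with rfl | rfl
    · exact ⟨g, false, g, true, rfl, Or.inl hg, Or.inl hg, hlr, by simp⟩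
    · refine ⟨g, true, g, false, ?_, Or.inl hg, Or.inl hg, hlr.symm, by simp⟩
      simp [join, child, childAnchor, hlr]
  · match i, h with
    | i + 1, h =>
      obtain ⟨l, la, c, ra, r, rfl, hl, hc, hr, hne, h1, h2⟩ := h
      have h1 : ∃ s, c = l.child s ∧ la = (l.childAnchor s).inv := by
        rcases h1 with h | h
        · exact ⟨false, by simpa [child, childAnchor] using h⟩
        · exact ⟨true, by simpa [child, childAnchor] using h⟩
      have h2 : ∃ s, c = r.child s ∧ ra = (r.childAnchor s).inv := by
        rcases h2 with h | h
        · exact ⟨false, by simpa [child, childAnchor] using h⟩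
        · exact ⟨true, by simpa [child, childAnchor] using h⟩
      obtain ⟨s, rfl, rfl⟩ := h1
      obtain ⟨t, ht, rfl⟩ := h2
      exact ⟨l, s, r, t, rfl, hl, hr, ht, fun h => absurd h hne⟩

/-- Used to tell `gxx` apart from the higher tuples in `ascend`, `descend` and `star`: only its left
entry is `1`. -/
theorem ne_one_of_mem {i : ℕ} {u : Term} (h : u ∈ G (i + 1)) : u ≠ one := by
  rcases i with _ | i
  · rw [mem_G_one.1 h]; simp [gxx, one]
  · obtain ⟨l, s, r, t, rfl, -⟩ := exists_join h
    simp [join, one]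

open Classical in
/-- The side of `u` on which the child `c` with anchor `a` lies. -/
noncomputable def side (u c : Term) (a : Anchor) : Bool :=
  if c = u.l ∧ a = u.la then false else true

theorem side_child {i : ℕ} {u : Term} (h : u ∈ G (i + 1)) (s : Bool) :
    side u (u.child s) (u.childAnchor s) = s := by
  have := child_ne_of_mem h
  cases s
  · simp [side, child, childAnchor]
  · exact if_neg fun h => this (Prod.ext h.1.symm h.2.symm)

/-! ### The duality -/

open Classical in
/-- The dual of a term: left and right are exchanged. -/
noncomputable def Term.star : Term → Term
  | anchor a => anchor a.inv
  | tuple l la c ra r =>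
    if tuple l la c ra r = gxx then gxx else tuple r.star ra c.star la l.star

/-- The plain exchange would give `(1, x', x', 1, 1)`, which is not a generator; but `gxx` stands
for `x x'`, which word reversal with `x ↔ x'` fixes. -/
theorem star_gxx : gxx.star = gxx := by
  rw [show gxx = .tuple .one .one (.anchor .x) .x' .one from rfl, Term.star]
  exact if_pos rfl

theorem star_join {i : ℕ} {l r : Term} {s t : Bool} (hl : l ∈ G (i + 1)) :
    (join l s r t).star =
      tuple r.star (r.childAnchor t).inv (l.child s).star (l.childAnchor s).inv l.star := by
  rw [join, Term.star, if_neg]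
  intro h
  exact ne_one_of_mem hl (congrArg Term.l h)

/-- The side changes except at `gxx`. The anchor is kept because `a' l a`, reversed with `a ↦ a'`,
is `a' l* a`. -/
theorem star_child {i : ℕ} {u : Term} (h : u ∈ G (i + 1)) (s : Bool) :
    ∃ s', u.star.child s' = (u.child s).star ∧ u.star.childAnchor s' = u.childAnchor s := by
  rcases i with _ | i
  · rw [mem_G_one.1 h, star_gxx]
    exact ⟨s, by cases s <;> rfl, rfl⟩
  · obtain ⟨l, s₁, r, t, rfl, hl, -⟩ := exists_join h
    rw [star_join hl]
    cases s
    · exact ⟨true, rfl, rfl⟩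
    · exact ⟨false, rfl, rfl⟩

theorem exists_star_join {i : ℕ} {l r : Term} {s t : Bool} (hl : l ∈ G (i + 1))
    (hr : r ∈ G (i + 1)) (hc : l.child s = r.child t) :
    ∃ s' t', (join l s r t).star = join r.star t' l.star s' ∧
      l.star.child s' = (l.child s).star ∧ l.star.childAnchor s' = l.childAnchor s ∧
      r.star.child t' = (l.child s).star ∧ r.star.childAnchor t' = r.childAnchor t := by
  obtain ⟨s', hs1, hs2⟩ := star_child hl s
  obtain ⟨t', ht1, ht2⟩ := star_child hr t
  refine ⟨s', t', ?_, hs1, hs2, hc ▸ ht1, ht2⟩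
  rw [star_join hl, join, ht1, ht2, hs2, hc]

theorem star_star_mem {i : ℕ} {u : Term} (h : u ∈ G i) : u.star ∈ G i ∧ u.star.star = u := by
  match i, h with
  | 0, h => rw [mem_G_zero.1 h]; exact ⟨mem_G_zero.2 rfl, rfl⟩
  | 1, h => rw [mem_G_one.1 h, star_gxx, star_gxx]; exact ⟨mem_G_one.2 rfl, rfl⟩
  | i + 2, h =>
    obtain ⟨l, s, r, t, rfl, hl, hr, hc, hne⟩ := exists_join h
    obtain ⟨hl1, hl2⟩ := star_star_mem hl
    obtain ⟨hr1, hr2⟩ := star_star_mem hr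
    obtain ⟨s', t', hj, hs1, hs2, ht1, ht2⟩ := exists_star_join hl hr hc
    refine ⟨?_, ?_⟩
    · rw [hj]
      refine join_mem hr1 hl1 (ht1.trans hs1.symm) ?_
      -- Equal duals would force `l = r`, and then `s` and `t` would name the same child with the
      -- same anchor.
      rintro h rfl
      have hlr : l = r := by rw [← hl2, ← hr2, h]
      refine hne hlr (side_unique hl (hc.trans (by rw [hlr])) ?_)
      rw [← hs2, ← h, ht2, hlr]
    · rw [hj, star_join hr1, hl2, hr2, ht1, ht2, hs2, (star_star_mem (child_mem hl s)).2, join]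

end WeakGen

namespace WeakGen
open Term

/-! ### The action on descending paths -/

/-- The end point of a descending path from `g`, given by the list of its sides, last one
first. -/
def dst (g : Term) : List Bool → Term
  | [] => g
  | s :: q => (dst g q).child s

open Classical in
/-- The ascent, after a descending path from `g` that ends at the child of `u` on the side `s`,
to `u`: either the last descent is undone, or the valley is filled. -/
noncomputable def up (g u : Term) (s : Bool) : List Bool → Option (List Bool)
  | [] => none
  | t :: q =>
    if dst g q = u ∧ t = s then some q
    else (up g (join u s (dst g q) t) true q).map (false :: ·)

open Classical in
/-- The ascent from `1` to `k` along its canonical path. -/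
noncomputable def ascend (g : Term) : Term → List Bool → Option (List Bool)
  | anchor _, p => some p
  | tuple l la c ra r, p =>
    if l = one then up g (tuple l la c ra r) false p
    else ((ascend g c p).bind (up g l (side l c la.inv))).bind (up g (tuple l la c ra r) false)

open Classical in
/-- The descent from `k` to `1` along its canonical path. -/
noncomputable def descend : Term → List Bool → List Bool
  | anchor _, p => p
  | tuple l _ c ra r, p =>
    if l = one then false :: p else descend c (side r c ra.inv :: true :: p)

/-- The action of an anchor on the descending paths from `g` to `1`. -/
noncomputable def stepAnchor (g : Term) : Anchor → List Bool → Option (List Bool)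
  | .one, p => some p
  | .x, p => (up g gxx false p).map (true :: ·)
  | .x', p => (up g gxx true p).map (false :: ·)

/-- The action of a letter on the descending paths from `g` to `1`, without the restriction to
such paths. -/
noncomputable def stepTerm (g : Term) : Term → List Bool → Option (List Bool)
  | anchor a, p => stepAnchor g a p
  | tuple l la c ra r, p => (ascend g (tuple l la c ra r) p).map (descend (tuple l la c ra r))

open Classical in
/-- The action of a letter on the descending paths from `g` to `1`. -/
noncomputable def step (g k : Term) (p : List Bool) : Option (List Bool) :=
  if dst g p = one then stepTerm g k p else none

section

variable {g : Term}

theorem up_cons_self (s : Bool) (p : List Bool) : up g (dst g p) s (s :: p) = some p := by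
  rw [up, if_pos ⟨rfl, rfl⟩]

theorem up_cons_of_ne {l : Term} {s t : Bool} {p : List Bool} (h : l = dst g p → s ≠ t) :
    up g l s (t :: p) = (up g (join l s (dst g p) t) true p).map (false :: ·) := by
  rw [up, if_neg]
  rintro ⟨h1, h2⟩
  exact h h1.symm h2.symm

theorem dst_up {u : Term} {s : Bool} {p q : List Bool} (h : up g u s p = some q) :
    dst g q = u := by
  induction p generalizing u s q with
  | nil => simp [up] at h
  | cons t p ih =>
    rw [up] at h
    split_ifs at h with h1
    · cases h; exact h1.1
    · obtain ⟨q', hq, rfl⟩ := Option.map_eq_some_iff.1 h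
      rw [dst, ih hq]; rfl

theorem length_up {u : Term} {s : Bool} {p q : List Bool} (h : up g u s p = some q) :
    p.length = q.length + 1 := by
  induction p generalizing u s q with
  | nil => simp [up] at h
  | cons t p ih =>
    rw [up] at h
    split_ifs at h with h1
    · cases h; rfl
    · obtain ⟨q', hq, rfl⟩ := Option.map_eq_some_iff.1 h
      simp [ih hq]

theorem ascend_gxx (p : List Bool) : ascend g gxx p = up g gxx false p := by
  rw [show gxx = .tuple .one .one (.anchor .x) .x' .one from rfl, ascend, if_pos rfl]

theorem descend_gxx (p : List Bool) : descend gxx p = false :: p := by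
  rw [show gxx = .tuple .one .one (.anchor .x) .x' .one from rfl, descend, if_pos rfl]

theorem descend_one (p : List Bool) : descend one p = p := rfl

theorem ascend_join {i : ℕ} {l r : Term} {s t : Bool} (hl : l ∈ G (i + 1)) (p : List Bool) :
    ascend g (join l s r t) p =
      ((ascend g (l.child s) p).bind (up g l s)).bind (up g (join l s r t) false) := by
  rw [join, ascend, if_neg (ne_one_of_mem hl), Anchor.inv_inv, side_child hl]

theorem descend_join {i : ℕ} {l r : Term} {s t : Bool} (hl : l ∈ G (i + 1)) (hr : r ∈ G (i + 1))
    (hc : l.child s = r.child t) (p : List Bool) :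
    descend (join l s r t) p = descend (l.child s) (t :: true :: p) := by
  rw [join, descend, if_neg (ne_one_of_mem hl), Anchor.inv_inv, hc, side_child hr]

theorem dst_descend : ∀ {i : ℕ} {k : Term}, k ∈ G i → ∀ {p : List Bool}, dst g p = k →
    dst g (descend k p) = one
  | 0, k, hk, p, hp => by rw [mem_G_zero.1 hk] at hp ⊢; exact hp
  | 1, k, hk, p, hp => by
    rw [mem_G_one.1 hk] at hp ⊢
    rw [descend_gxx, dst, hp]; rfl
  | i + 2, k, hk, p, hp => by
    obtain ⟨l, s, r, t, rfl, hl, hr, hc, hne⟩ := exists_join hk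
    rw [descend_join hl hr hc]
    refine dst_descend (child_mem hl s) ?_
    rw [dst, dst, hp, hc]; rfl

theorem dst_ascend {i : ℕ} {k : Term} (hk : k ∈ G i) {p q : List Bool} (hp : dst g p = one)
    (h : ascend g k p = some q) : dst g q = k := by
  match i, hk with
  | 0, hk => rw [mem_G_zero.1 hk] at h ⊢; cases h; exact hp
  | 1, hk => rw [mem_G_one.1 hk, ascend_gxx] at h; rw [mem_G_one.1 hk, dst_up h]
  | i + 2, hk =>
    obtain ⟨l, s, r, t, rfl, hl, hr, hc, hne⟩ := exists_join hk
    rw [ascend_join hl] at h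
    obtain ⟨q', -, h⟩ := Option.bind_eq_some_iff.1 h
    exact dst_up h

/-- Each elementary rise shortens the path by one, whether it cancels a descent or fills valleys. -/
theorem length_ascend : ∀ {i : ℕ} {k : Term}, k ∈ G i → ∀ {p q : List Bool},
    ascend g k p = some q → p.length = q.length + i
  | 0, k, hk, p, q, h => by rw [mem_G_zero.1 hk] at h; cases h; rfl
  | 1, k, hk, p, q, h => by rw [mem_G_one.1 hk, ascend_gxx] at h; exact length_up h
  | i + 2, k, hk, p, q, h => by
    obtain ⟨l, s, r, t, rfl, hl, hr, hc, hne⟩ := exists_join hk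
    rw [ascend_join hl] at h
    obtain ⟨q', h', h⟩ := Option.bind_eq_some_iff.1 h
    obtain ⟨q'', h'', h'⟩ := Option.bind_eq_some_iff.1 h'
    have := length_ascend (child_mem hl s) h''
    have := length_up h'
    have := length_up h
    omega

theorem length_descend : ∀ {i : ℕ} {k : Term}, k ∈ G i → ∀ (p : List Bool),
    (descend k p).length = p.length + i
  | 0, k, hk, p => by rw [mem_G_zero.1 hk]; rfl
  | 1, k, hk, p => by rw [mem_G_one.1 hk, descend_gxx]; rfl
  | i + 2, k, hk, p => by
    obtain ⟨l, s, r, t, rfl, hl, hr, hc, hne⟩ := exists_join hk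
    rw [descend_join hl hr hc, length_descend (child_mem hl s)]
    simp; omega

theorem step_eq {i : ℕ} {k : Term} (hk : k ∈ G i) {p : List Bool} (hp : dst g p = one) :
    step g k p = (ascend g k p).map (descend k) := by
  rw [step, if_pos hp]
  rcases i with _ | i
  · rw [mem_G_zero.1 hk]; rfl
  · cases k with
    | anchor a =>
      rcases i with _ | i
      · cases mem_G_one.1 hk
      · obtain ⟨l, s, r, t, h, -⟩ := exists_join hk
        cases h
    | tuple => rfl

theorem step_anchor {a : Anchor} {p : List Bool} (hp : dst g p = one) :
    step g (anchor a) p = stepAnchor g a p := by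
  rw [step, if_pos hp]; rfl

theorem dst_of_stepAnchor {a : Anchor} {p q : List Bool} (hp : dst g p = one)
    (h : stepAnchor g a p = some q) : dst g q = one := by
  cases a with
  | one => cases h; exact hp
  | x =>
    obtain ⟨q', hq, rfl⟩ := Option.map_eq_some_iff.1 h
    rw [dst, dst_up hq]; rfl
  | x' =>
    obtain ⟨q', hq, rfl⟩ := Option.map_eq_some_iff.1 h
    rw [dst, dst_up hq]; rfl

theorem length_stepAnchor {a : Anchor} {p q : List Bool}
    (h : stepAnchor g a p = some q) : p.length = q.length := by
  cases a with
  | one => cases h; rfl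
  | x =>
    obtain ⟨q', hq, rfl⟩ := Option.map_eq_some_iff.1 h
    exact length_up hq
  | x' =>
    obtain ⟨q', hq, rfl⟩ := Option.map_eq_some_iff.1 h
    exact length_up hq

theorem dst_of_step_eq_some {k : Term} {p q : List Bool} (h : step g k p = some q) :
    dst g p = one := by
  by_contra hp
  rw [step, if_neg hp] at h
  cases h

theorem dst_step {k : Term} (hk : IsGen k) {p q : List Bool} (h : step g k p = some q) :
    dst g q = one := by
  have hp := dst_of_step_eq_some h
  rcases hk with ⟨a, rfl⟩ | ⟨i, -, hk⟩
  · exact dst_of_stepAnchor hp (step_anchor hp ▸ h)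
  · rw [step_eq hk hp] at h
    obtain ⟨q', hq, rfl⟩ := Option.map_eq_some_iff.1 h
    exact dst_descend hk (dst_ascend hk hp hq)

theorem length_step {k : Term} (hk : IsGen k) {p q : List Bool} (h : step g k p = some q) :
    p.length = q.length := by
  have hp := dst_of_step_eq_some h
  rcases hk with ⟨a, rfl⟩ | ⟨i, -, hk⟩
  · exact length_stepAnchor (step_anchor hp ▸ h)
  · rw [step_eq hk hp] at h
    obtain ⟨q', hq, rfl⟩ := Option.map_eq_some_iff.1 h
    rw [length_ascend hk hq, length_descend hk]

/-- Descending to the middle entry from the right and ascending to the left entry amounts to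
ascending from the right entry to the tuple and descending to the left entry. -/
theorem up_cons_join {l r : Term} {s t : Bool} (hne : l = r → s ≠ t) {p : List Bool}
    (hp : dst g p = r) :
    up g l s (t :: p) = (up g (join l s r t) true p).map (false :: ·) := by
  subst hp
  exact up_cons_of_ne hne

/-- The descent runs through `r` and the ascent through `l`, but the valley between them at the
middle entry is filled by `k` itself. -/
theorem ascend_descend : ∀ {i : ℕ} {k : Term}, k ∈ G i → ∀ {p : List Bool}, dst g p = k →
    ascend g k (descend k p) = some p
  | 0, k, hk, p, hp => by rw [mem_G_zero.1 hk]; rfl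
  | 1, k, hk, p, hp => by
    rw [mem_G_one.1 hk] at hp ⊢
    rw [descend_gxx, ascend_gxx, ← hp, up_cons_self]
  | i + 2, k, hk, p, hp => by
    obtain ⟨l, s, r, t, rfl, hl, hr, hc, hne⟩ := exists_join hk
    have hr' : dst g (true :: p) = r := by rw [dst, hp]; rfl
    have hu : up g (join l s r t) true (true :: p) = some p := hp ▸ up_cons_self true p
    have hv : up g (join l s r t) false (false :: p) = some p := hp ▸ up_cons_self false p
    rw [descend_join hl hr hc, ascend_join hl,
      ascend_descend (child_mem hl s) (by rw [dst, hr', hc]), Option.bind_some,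
      up_cons_join hne hr', hu, Option.map_some, Option.bind_some, hv]

/-- In the action, ascending from a child `c` of `u` to `u` amounts to the word
`c a u`, and descending amounts to `u a' c`. -/
theorem ascend_child_and_descend_child : ∀ {i : ℕ} {u : Term}, u ∈ G (i + 1) →
    ∀ (s : Bool) {p : List Bool},
    (dst g p = u.child s →
      (step g (anchor (u.childAnchor s)) (descend (u.child s) p)).bind (ascend g u) =
        up g u s p) ∧
    (dst g p = u →
      (step g (anchor (u.childAnchor s).inv) (descend u p)).bind (ascend g (u.child s)) =
        some (s :: p))
  | 0, u, hu, s, p => by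
    have h1 : ∀ {p q s}, up g gxx s p = some q → dst g (s :: q) = one := fun h => by
      rw [dst, dst_up h]; cases ‹Bool› <;> rfl
    rw [mem_G_one.1 hu]
    have hch : gxx.child s = one := by cases s <;> rfl
    rw [hch]
    refine ⟨fun hp => ?_, fun hp => ?_⟩
    · rw [descend_one, step_anchor hp]
      cases s
      · exact ascend_gxx p
      · change ((up g gxx true p).map (false :: ·)).bind (ascend g gxx) = _
        cases h : up g gxx true p with
        | none => rfl
        | some q =>
          rw [Option.map_some, Option.bind_some, ascend_gxx, ← dst_up h, up_cons_self]
    · have hs : ∀ s, up g gxx s (s :: p) = some p := fun s => hp ▸ up_cons_self s p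
      rw [descend_gxx, step_anchor (by rw [dst, hp]; rfl)]
      cases s
      · rfl
      · change ((up g gxx false (false :: p)).map (true :: ·)).bind (ascend g one) = _
        rw [hs]; rfl
  | i + 1, u, hu, s, p => by
    obtain ⟨l, s₁, r, t, rfl, hl, hr, hc, hne⟩ := exists_join hu
    have ihl := @ascend_child_and_descend_child i l hl s₁
    have ihr := @ascend_child_and_descend_child i r hr t
    have key : ∀ {q}, dst g q = r → up g l s₁ (t :: q) =
        (up g (join l s₁ r t) true q).map (false :: ·) := fun hq => up_cons_join hne hq
    have hasc : ∀ o : Option (List Bool), o.bind (ascend g (join l s₁ r t)) =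
        ((o.bind (ascend g (l.child s₁))).bind (up g l s₁)).bind
          (up g (join l s₁ r t) false) := fun o => by
      cases o with
      | none => rfl
      | some o => exact ascend_join hl o
    refine ⟨fun hp => ?_, fun hp => ?_⟩
    · rw [hasc]
      cases s
      · change dst g p = l at hp
        change (((step g (anchor (l.childAnchor s₁).inv) (descend l p)).bind _).bind _).bind _ = _
        rw [ihl.2 hp, Option.bind_some]
        have : up g l s₁ (s₁ :: p) = some p := hp ▸ up_cons_self s₁ p
        rw [this, Option.bind_some]
      · change dst g p = r at hp
        change (((step g (anchor (r.childAnchor t).inv) (descend r p)).bind _).bind _).bind _ = _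
        -- The rise from the middle entry to `l` fills the valley below `r`, so it passes through
        -- the join and ends with a left descent, which the last rise undoes.
        rw [hc, ihr.2 hp, Option.bind_some, key hp]
        cases h : up g (join l s₁ r t) true p with
        | none => rfl
        | some q =>
          rw [Option.map_some, Option.bind_some]
          exact dst_up h ▸ up_cons_self false q
    · have hr' : dst g (true :: p) = r := by rw [dst, hp]; rfl
      have hc' : dst g (t :: true :: p) = l.child s₁ := by rw [dst, hr', hc]
      -- The canonical descent passes through `r` to the middle entry. Rising to `l` fills the
      -- valley and cancels the descent to `r`; rising to `r` only undoes the last descent.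
      rw [descend_join hl hr hc]
      cases s
      · change (step g (anchor (l.childAnchor s₁).inv.inv) _).bind (ascend g l) = _
        rw [Anchor.inv_inv, ihl.1 hc', key hr']
        have : up g (join l s₁ r t) true (true :: p) = some p := hp ▸ up_cons_self true p
        rw [this, Option.map_some]
      · change (step g (anchor (r.childAnchor t).inv.inv) _).bind (ascend g r) = _
        rw [Anchor.inv_inv, hc, ihr.1 (by rw [hc', hc])]
        exact hr' ▸ up_cons_self t (true :: p)

/-! ### The action of words -/

end

/-- The action of words on the descending paths from `g` to `1`, together with a zero. -/
noncomputable def runHom (g : Term) : Word →ₙ* (Function.End (Option (List Bool)))ᵐᵒᵖ :=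
  FreeSemigroup.lift fun k => MulOpposite.op fun o => o.bind (step g k.1)

/-- The action of a word on a descending path from `g` to `1`. -/
noncomputable def run (g : Term) (w : Word) (o : Option (List Bool)) : Option (List Bool) :=
  (runHom g w).unop o

section

variable {g : Term}

theorem run_letter (k : Gen) (o : Option (List Bool)) : run g (letter k) o = o.bind (step g k.1) :=
  rfl

/-- Words act on the right, first letter first; hence the opposite monoid in `runHom`. -/
theorem run_mul (v w : Word) (o : Option (List Bool)) : run g (v * w) o = run g w (run g v o) := by
  rw [run, map_mul]; rfl

theorem run_anc (a : Anchor) (o : Option (List Bool)) :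
    run g (anc a) o = o.bind (step g (anchor a)) := rfl

theorem run_none (w : Word) : run g w none = none := by
  induction w using FreeSemigroup.recOnMul with
  | ih1 k => rfl
  | ih2 k w h1 h2 => rw [run_mul]; erw [h1, h2]

theorem run_of_ne {p : List Bool} (hp : dst g p ≠ one) (w : Word) : run g w (some p) = none := by
  have h : ∀ k : Gen, run g (letter k) (some p) = none := fun k => by
    rw [run_letter, Option.bind_some, step, if_neg hp]
  induction w using FreeSemigroup.recOnMul with
  | ih1 k => exact h k
  | ih2 k w h1 h2 => rw [run_mul]; erw [h k, run_none]

end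
end WeakGen

/-! ### The defining relations hold in the action -/

namespace WeakGen
open Term

section

variable {g : Term}

theorem bind_step_eq {i : ℕ} {k : Term} (hk : k ∈ G i) {o : Option (List Bool)}
    (ho : ∀ p, o = some p → dst g p = one) :
    o.bind (step g k) = (o.bind (ascend g k)).map (descend k) := by
  cases o with
  | none => rfl
  | some p => exact step_eq hk (ho p rfl)

theorem bind_step_ascent {i : ℕ} {u : Term} (hu : u ∈ G (i + 1)) (s : Bool)
    {o : Option (List Bool)} (ho : ∀ p, o = some p → dst g p = u.child s) :
    ((o.map (descend (u.child s))).bind (step g (anchor (u.childAnchor s)))).bind (step g u) =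
      (o.bind (up g u s)).map (descend u) := by
  cases o with
  | none => rfl
  | some p =>
    rw [Option.map_some, Option.bind_some, Option.bind_some,
      bind_step_eq hu fun q hq => dst_step (Or.inl ⟨_, rfl⟩) hq,
      (ascend_child_and_descend_child hu s).1 (ho p rfl)]

theorem bind_step_descent {i : ℕ} {u : Term} (hu : u ∈ G (i + 1)) (s : Bool)
    {o : Option (List Bool)} (ho : ∀ p, o = some p → dst g p = u) :
    ((o.map (descend u)).bind (step g (anchor (u.childAnchor s).inv))).bind
      (step g (u.child s)) = (o.map (s :: ·)).map (descend (u.child s)) := by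
  cases o with
  | none => rfl
  | some p =>
    rw [Option.map_some, Option.bind_some,
      bind_step_eq (child_mem hu s) fun q hq => dst_step (Or.inl ⟨_, rfl⟩) hq,
      (ascend_child_and_descend_child hu s).2 (ho p rfl)]
    rfl

theorem dst_ascend' {i : ℕ} {k : Term} (hk : k ∈ G i) {p : List Bool} (hp : dst g p = one) :
    ∀ q, ascend g k p = some q → dst g q = k := fun _ h => dst_ascend hk hp h

theorem dst_bind_up {u : Term} {s : Bool} {o : Option (List Bool)} :
    ∀ q, o.bind (up g u s) = some q → dst g q = u := fun q h => by
  obtain ⟨p, -, h⟩ := Option.bind_eq_some_iff.1 h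
  exact dst_up h

theorem step_gxx {p : List Bool} (hp : dst g p = one) :
    step g gxx p = (up g gxx false p).map (false :: ·) := by
  rw [step_eq (mem_G_one.2 rfl) hp, ascend_gxx, funext descend_gxx]

theorem dst_cons_gxx {q : List Bool} (h : dst g q = gxx) (s : Bool) : dst g (s :: q) = one := by
  rw [dst, h]; cases s <;> rfl

theorem step_one {p : List Bool} (hp : dst g p = one) : step g one p = some p :=
  step_anchor hp

theorem bind_step_x {o : Option (List Bool)} (ho : ∀ q, o = some q → dst g q = gxx) :
    (o.map (false :: ·)).bind (step g (anchor .x)) = o.map (true :: ·) := by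
  cases o with
  | none => rfl
  | some q =>
    have hq := ho q rfl
    have : up g gxx false (false :: q) = some q := hq ▸ up_cons_self false q
    rw [Option.map_some, Option.bind_some, step_anchor (dst_cons_gxx hq _), stepAnchor, this]

theorem bind_step_x' {o : Option (List Bool)} (ho : ∀ q, o = some q → dst g q = gxx) :
    (o.map (true :: ·)).bind (step g (anchor .x')) = o.map (false :: ·) := by
  cases o with
  | none => rfl
  | some q =>
    have hq := ho q rfl
    have : up g gxx true (true :: q) = some q := hq ▸ up_cons_self true q
    rw [Option.map_some, Option.bind_some, step_anchor (dst_cons_gxx hq _), stepAnchor, this]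

theorem run_rel {v w : Word} (h : Rel v w) : run g v = run g w := by
  funext o
  rcases o with _ | p
  · rw [run_none, run_none]
  -- Every letter sends a list that does not end at `1` to `none`, so only genuine paths to `1`
  -- matter.
  by_cases hp : dst g p = one
  swap
  · rw [run_of_ne hp, run_of_ne hp]
  cases h with
  | x_reg =>
    simp only [run_mul, run_anc, Option.bind_some, step_anchor hp]
    rw [stepAnchor, bind_step_x' fun q hq => dst_up hq, bind_step_x fun q hq => dst_up hq]
  | x'_reg =>
    simp only [run_mul, run_anc, Option.bind_some, step_anchor hp]
    rw [stepAnchor, bind_step_x fun q hq => dst_up hq, bind_step_x' fun q hq => dst_up hq]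
  | gxx_eq =>
    simp only [run_mul, run_anc, Option.bind_some, step_anchor hp, run_letter]
    rw [stepAnchor, bind_step_x' fun q hq => dst_up hq]
    exact step_gxx hp
  | one_left k =>
    simp only [run_mul, run_anc, run_letter, Option.bind_some]
    rw [show anchor .one = one from rfl, step_one hp, Option.bind_some]
  | one_right k =>
    simp only [run_mul, run_anc, run_letter, Option.bind_some]
    cases h : step g k.1 p with
    | none => rfl
    | some q => exact step_one (dst_step k.2 h)
  | idem i k hk =>
    simp only [run_mul, run_letter, Option.bind_some]
    rw [bind_step_eq hk fun q hq => dst_step k.2 hq, step_eq hk hp]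
    cases h : ascend g k.1 p with
    | none => rfl
    | some q =>
      rw [Option.map_some, Option.bind_some, ascend_descend hk (dst_ascend hk hp h),
        Option.map_some]
  | sandwich_left i hi k hk =>
    obtain ⟨i, rfl⟩ := Nat.exists_eq_add_of_le' hi
    obtain ⟨l, s, r, t, hu, hl, hr, hc, hne⟩ := exists_join hk
    obtain ⟨k, hgen⟩ := k
    dsimp only at hu hk
    subst hu
    simp only [run_mul, run_letter, wordL, run_anc, Option.bind_some]
    change (((((step g (l.child s) p).bind (step g (anchor (l.childAnchor s).inv.inv))).bind
      (step g l)).bind (step g (anchor ((join l s r t).childAnchor false))))).bind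
      (step g (join l s r t)) = step g (join l s r t) p
    -- The prefix `g^c g^L` retraces the canonical ascent through the middle and the left entry.
    rw [Anchor.inv_inv, step_eq (child_mem hl s) hp,
      bind_step_ascent hl s (dst_ascend' (child_mem hl s) hp)]
    erw [bind_step_ascent hk false dst_bind_up]
    rw [step_eq hk hp, ascend_join hl]
    rfl
  | sandwich_right i hi k hk =>
    obtain ⟨i, rfl⟩ := Nat.exists_eq_add_of_le' hi
    obtain ⟨l, s, r, t, hu, hl, hr, hc, hne⟩ := exists_join hk
    obtain ⟨k, hgen⟩ := k
    dsimp only at hu hk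
    subst hu
    simp only [run_mul, run_letter, wordR, run_anc]
    change (((((step g (join l s r t) p).bind
      (step g (anchor ((join l s r t).childAnchor true).inv))).bind
      (step g ((join l s r t).child true))).bind (step g (anchor (r.childAnchor t).inv)))).bind
      (step g (l.child s)) = step g (join l s r t) p
    -- The suffix `g^R g^c` retraces the canonical descent through the right and the middle entry.
    rw [hc, step_eq hk hp, bind_step_descent hk true (dst_ascend' hk hp)]
    have hr' : ∀ q, (ascend g (join l s r t) p).map (true :: ·) = some q → dst g q = r := by
      intro q hq
      obtain ⟨q', hq', rfl⟩ := Option.map_eq_some_iff.1 hq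
      rw [dst, dst_ascend hk hp hq']; rfl
    erw [bind_step_descent hr t hr']
    rw [Option.map_map, Option.map_map]
    congr 1
    funext q
    rw [descend_join hl hr hc, hc]; rfl
  | sandwich_mid i hi k hk =>
    obtain ⟨i, rfl⟩ := Nat.exists_eq_add_of_le' hi
    obtain ⟨l, s, r, t, hu, hl, hr, hc, hne⟩ := exists_join hk
    obtain ⟨k, hgen⟩ := k
    dsimp only at hu hk
    subst hu
    simp only [run_mul, run_letter, run_anc, Option.bind_some]
    change (((((step g r p).bind (step g (anchor ((join l s r t).childAnchor true)))).bind
      (step g (join l s r t))).bind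
      (step g (anchor ((join l s r t).childAnchor false).inv)))).bind
      (step g ((join l s r t).child false)) =
      (((((step g r p).bind (step g (anchor (r.childAnchor t).inv))).bind
      (step g (l.child s))).bind (step g (anchor (l.childAnchor s).inv.inv)))).bind (step g l)
    have hr' := dst_ascend' hr hp
    rw [step_eq hr hp]
    erw [bind_step_ascent hk true hr']
    -- One side goes from `r` up to the join and down to `l`, the other from `r` down to the middle
    -- entry and up to `l`; they agree by the valley rule `up_cons_join`.
    rw [bind_step_descent hk false dst_bind_up, hc, bind_step_descent hr t hr', ← hc,
      Anchor.inv_inv, bind_step_ascent hl s]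
    · cases h : ascend g r p with
      | none => rfl
      | some q =>
        rw [Option.map_some, Option.bind_some, Option.bind_some, up_cons_join hne (hr' q h)]
        rfl
    · intro q hq
      obtain ⟨q', hq', rfl⟩ := Option.map_eq_some_iff.1 hq
      rw [dst, hr' q' hq', hc]

theorem run_congr {v w : Word} (h : conGen Rel v w) : run g v = run g w := by
  have : conGen Rel ≤ Con.ker (runHom g) :=
    Con.conGen_le.2 fun v w h => MulOpposite.unop_injective (run_rel h)
  exact congrArg MulOpposite.unop (this h)

end

/-- The action of `F¹` on the descending paths from `g` to `1`, together with a zero. -/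
noncomputable def act (g : Term) (a : F1) (o : Option (List Bool)) : Option (List Bool) :=
  Con.liftOn a (fun w => run g w o) fun _ _ h => congrFun (run_congr h) o

theorem exists_mk (a : F1) : ∃ w, a = mk w :=
  Con.induction_on a fun w => ⟨w, rfl⟩

theorem act_mul (g : Term) (a b : F1) (o : Option (List Bool)) :
    act g (a * b) o = act g b (act g a o) := by
  obtain ⟨v, rfl⟩ := exists_mk a
  obtain ⟨w, rfl⟩ := exists_mk b
  exact run_mul v w o

end WeakGen

namespace WeakGen
open Term

/-! ### Descending paths as elements of `F¹` -/

open Classical in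
/-- The class of a term that is a generator. -/
noncomputable def gen (t : Term) : F1 := if h : IsGen t then mk (letter ⟨t, h⟩) else mk (anc .one)

/-- The class of an anchor. -/
def ganc (a : Anchor) : F1 := mk (anc a)

theorem gen_eq {t : Term} (h : IsGen t) : gen t = mk (letter ⟨t, h⟩) := dif_pos h

theorem mk_letter (k : Gen) : mk (letter k) = gen k.1 := (gen_eq k.2).symm

theorem mk_mul (v w : Word) : mk (v * w) = mk v * mk w := rfl

theorem mk_rel {v w : Word} (h : Rel v w) : mk v = mk w :=
  (Con.eq _).2 (ConGen.Rel.of _ _ h)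

theorem ganc_eq (a : Anchor) : ganc a = gen (anchor a) := mk_letter (Gen.anchor a)

theorem gen_induction {P : F1 → Prop} (h1 : ∀ k, IsGen k → P (gen k))
    (h2 : ∀ k a, IsGen k → P a → P (gen k * a)) (a : F1) : P a := by
  obtain ⟨w, rfl⟩ := exists_mk a
  induction w using FreeSemigroup.recOnMul with
  | ih1 k => exact (mk_letter k).symm ▸ h1 k.1 k.2
  | ih2 k w _ h =>
    have := h2 k.1 _ k.2 h
    rwa [← mk_letter] at this

theorem ganc_one_mul (a : F1) : ganc .one * a = a := by
  have h : ∀ k, IsGen k → ganc .one * gen k = gen k := fun k hk => by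
    rw [gen_eq hk]
    exact mk_rel (Rel.one_left _)
  induction a using gen_induction with
  | h1 k hk => exact h k hk
  | h2 k a hk _ => rw [← mul_assoc, h k hk]

theorem mul_ganc_one (a : F1) : a * ganc .one = a := by
  induction a using gen_induction with
  | h1 k hk =>
    rw [gen_eq hk]
    exact mk_rel (Rel.one_right _)
  | h2 k a hk h => rw [mul_assoc, h]

theorem mul_gen_one (a : F1) : a * gen one = a := by
  rw [one, ← ganc_eq, mul_ganc_one]

theorem gen_mul_self {i : ℕ} {k : Term} (hk : k ∈ G i) : gen k * gen k = gen k := by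
  have := mk_rel (Rel.idem i (Gen.ofMem hk) hk)
  rwa [mk_mul, mk_letter] at this

theorem gen_gxx : gen gxx = ganc .x * ganc .x' := by
  have := mk_rel Rel.gxx_eq
  rwa [mk_mul, mk_letter] at this

/-- With its companion for `x'`, this justifies `stepAnchor`: `x` rises to `gxx` on the left and
descends on the right, `x'` the other way round. -/
theorem gen_gxx_mul_x : gen gxx * ganc .x = ganc .x := by
  rw [gen_gxx]; exact mk_rel Rel.x_reg

theorem x'_mul_gen_gxx : ganc .x' * gen gxx = ganc .x' := by
  rw [gen_gxx, ← mul_assoc]; exact mk_rel Rel.x'_reg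

section

variable {i : ℕ} {l r : Term} {s t : Bool}

theorem sandwich_left (h : join l s r t ∈ G (i + 2)) :
    gen (l.child s) * (ganc (l.childAnchor s) * (gen l * (ganc (l.childAnchor s).inv *
      gen (join l s r t)))) = gen (join l s r t) := by
  have := mk_rel (Rel.sandwich_left (i + 2) (by omega) (Gen.ofMem h) h)
  simp only [wordL, mk_mul, mk_letter, mul_assoc] at this
  change gen (l.child s) * (ganc (l.childAnchor s).inv.inv * (gen l *
    (ganc (l.childAnchor s).inv * gen (join l s r t)))) = _ at this
  rwa [Anchor.inv_inv] at this

theorem sandwich_right (h : join l s r t ∈ G (i + 2)) :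
    gen (join l s r t) * (ganc (r.childAnchor t) * (gen r * (ganc (r.childAnchor t).inv *
      gen (l.child s)))) = gen (join l s r t) := by
  have := mk_rel (Rel.sandwich_right (i + 2) (by omega) (Gen.ofMem h) h)
  simp only [wordR, mk_mul, mk_letter, mul_assoc] at this
  change gen (join l s r t) * (ganc (r.childAnchor t).inv.inv * (gen r *
    (ganc (r.childAnchor t).inv * gen (l.child s)))) = _ at this
  rwa [Anchor.inv_inv] at this

theorem sandwich_mid (h : join l s r t ∈ G (i + 2)) :
    gen r * (ganc (r.childAnchor t).inv * (gen (join l s r t) * (ganc (l.childAnchor s) *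
      gen l))) =
    gen r * (ganc (r.childAnchor t).inv * (gen (l.child s) * (ganc (l.childAnchor s) *
      gen l))) := by
  have := mk_rel (Rel.sandwich_mid (i + 2) (by omega) (Gen.ofMem h) h)
  simp only [mk_mul, mk_letter, mul_assoc] at this
  change gen r * (ganc (r.childAnchor t).inv * (gen (join l s r t) *
    (ganc (l.childAnchor s).inv.inv * gen l))) =
    gen r * (ganc (r.childAnchor t).inv * (gen (l.child s) *
    (ganc (l.childAnchor s).inv.inv * gen l))) at this
  rwa [Anchor.inv_inv] at this

end

/-- A descent followed by the opposite rise cancels. Above height one, the sandwich relations give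
`g g^c = g = g^c g`, so `g g^L g = g (g^c g^L g) = g g = g`, and similarly for `g^R`. -/
theorem gen_child_gen {i : ℕ} {u : Term} (hu : u ∈ G (i + 1)) (s : Bool) :
    gen u * (ganc (u.childAnchor s).inv * (gen (u.child s) * (ganc (u.childAnchor s) * gen u))) =
      gen u := by
  rcases i with _ | i
  · rw [mem_G_one.1 hu]
    cases s
    · change gen gxx * (ganc .one * (gen (.anchor .one) * (ganc .one * gen gxx))) = gen gxx
      simp only [← ganc_eq, ganc_one_mul]
      exact gen_mul_self (mem_G_one.2 rfl)
    · change gen gxx * (ganc .x * (gen (.anchor .one) * (ganc .x' * gen gxx))) = gen gxx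
      rw [← ganc_eq, ganc_one_mul, x'_mul_gen_gxx, ← mul_assoc, gen_gxx_mul_x, gen_gxx]
  · obtain ⟨l, s₁, r, t, rfl, hl, hr, hc, hne⟩ := exists_join hu
    have hcc := gen_mul_self (child_mem hl s₁)
    have huu := gen_mul_self hu
    have hL := sandwich_left hu
    have hR := sandwich_right hu
    cases s
    · have huc : gen (join l s₁ r t) * gen (l.child s₁) = gen (join l s₁ r t) := by
        conv_lhs => rw [← hR]
        simp only [mul_assoc, hcc]
        exact hR
      change gen (join l s₁ r t) * (ganc (l.childAnchor s₁).inv.inv * (gen l *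
        (ganc (l.childAnchor s₁).inv * gen (join l s₁ r t)))) = gen (join l s₁ r t)
      rw [Anchor.inv_inv, ← huc, mul_assoc, huc, hL, huu]
    · have hcu : gen (l.child s₁) * gen (join l s₁ r t) = gen (join l s₁ r t) := by
        conv_lhs => rw [← hL]
        rw [← mul_assoc, hcc, hL]
      change gen (join l s₁ r t) * (ganc (r.childAnchor t).inv.inv * (gen r *
        (ganc (r.childAnchor t).inv * gen (join l s₁ r t)))) = gen (join l s₁ r t)
      rw [Anchor.inv_inv, ← hcu]
      simp only [← mul_assoc] at hR ⊢
      rw [hcu, hR, huu]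

/-- The element of `F¹` given by a descending path from `g`. -/
noncomputable def path (g : Term) : List Bool → F1
  | [] => gen g
  | s :: q => path g q * (ganc ((dst g q).childAnchor s).inv * gen ((dst g q).child s))

section

variable {g : Term} {n : ℕ} (hg : g ∈ G n)

include hg

theorem dst_mem {p : List Bool} {m : ℕ} (h : p.length + m = n) : dst g p ∈ G m := by
  induction p generalizing m with
  | nil => rw [List.length_nil, zero_add] at h; exact h ▸ hg
  | cons s p ih => exact child_mem (ih (by rw [← h, List.length_cons]; omega)) s

theorem dst_eq_one {p : List Bool} (h : p.length = n) : dst g p = one :=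
  mem_G_zero.1 (dst_mem hg h)

theorem path_mul_gen {p : List Bool} {m : ℕ} (h : p.length + m = n) :
    path g p * gen (dst g p) = path g p := by
  have := gen_mul_self (dst_mem hg h)
  cases p with
  | nil => exact this
  | cons s p =>
    rw [dst] at this
    rw [path, dst, mul_assoc, mul_assoc, this]

theorem path_cons_mul {p : List Bool} {m : ℕ} (h : p.length + (m + 1) = n) (s : Bool) :
    path g (s :: p) * (ganc ((dst g p).childAnchor s) * gen (dst g p)) = path g p := by
  rw [path, ← path_mul_gen hg h]
  simp only [mul_assoc]
  rw [gen_child_gen (dst_mem hg h)]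

/-- A cancelled descent is `gen_child_gen`; a filled valley is `sandwich_mid` for the join, followed
by induction for the rise to that join. -/
theorem path_mul_up {p q : List Bool} {m : ℕ} (h : p.length + m = n) {u : Term} {s : Bool}
    (hu : u ∈ G (m + 1)) (hp : dst g p = u.child s) (hq : up g u s p = some q) :
    path g p * (ganc (u.childAnchor s) * gen u) = path g q := by
  induction p generalizing u s m q with
  | nil => simp [up] at hq
  | cons t p ih =>
    have hm : p.length + (m + 1) = n := by rw [← h, List.length_cons]; omega
    by_cases he : dst g p = u ∧ t = s
    · obtain ⟨rfl, rfl⟩ := he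
      rw [up_cons_self] at hq
      cases hq
      exact path_cons_mul hg hm t
    · have hne : u = dst g p → s ≠ t := fun h1 h2 => he ⟨h1.symm, h2.symm⟩
      rw [up_cons_of_ne hne] at hq
      obtain ⟨q, hq', rfl⟩ := Option.map_eq_some_iff.1 hq
      have hK : join u s (dst g p) t ∈ G (m + 2) := join_mem hu (dst_mem hg hm) hp.symm hne
      have := ih hm hK rfl hq'
      rw [path, path, dst_up hq', ← this, ← path_mul_gen hg hm]
      change _ = path g p * gen (dst g p) * (ganc ((dst g p).childAnchor t).inv * gen _) *
        (ganc (u.childAnchor s).inv.inv * gen u)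
      rw [Anchor.inv_inv]
      simp only [mul_assoc]
      rw [sandwich_mid hK, ← hp, dst]

theorem path_mul_ascend : ∀ {m : ℕ} {k : Term}, k ∈ G m → ∀ {p q : List Bool}, p.length = n →
    ascend g k p = some q → path g p * gen k = path g q
  | 0, k, hk, p, q, hp, h => by
    rw [mem_G_zero.1 hk] at h ⊢
    cases h
    exact mul_gen_one _
  | 1, k, hk, p, q, hp, h => by
    have := path_mul_up hg (m := 0) hp (s := false) hk
      (by rw [dst_eq_one hg hp, mem_G_one.1 hk]; rfl) (by
        rw [mem_G_one.1 hk] at h ⊢; rwa [ascend_gxx] at h)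
    rw [mem_G_one.1 hk] at this ⊢
    rw [← this]
    change _ = _ * (ganc .one * _)
    rw [ganc_one_mul]
  | m + 2, k, hk, p, q, hp, h => by
    obtain ⟨l, s, r, t, rfl, hl, hr, hc, hne⟩ := exists_join hk
    have hlen := length_ascend hk h
    rw [ascend_join hl] at h
    obtain ⟨q₂, h, h3⟩ := Option.bind_eq_some_iff.1 h
    obtain ⟨q₁, h1, h2⟩ := Option.bind_eq_some_iff.1 h
    have l2 := length_up h2
    have l3 := length_up h3
    have e1 := path_mul_ascend (child_mem hl s) hp h1
    have e2 := path_mul_up hg (m := m) (by omega) hl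
      (dst_ascend (child_mem hl s) (dst_eq_one hg hp) h1) h2
    have e3 := path_mul_up hg (m := m + 1) (s := false) (by omega) hk (dst_up h2) h3
    rw [← e3, ← e2, ← e1]
    simp only [mul_assoc]
    exact congrArg (path g p * ·) (sandwich_left hk).symm

theorem path_descend : ∀ {m : ℕ} {k : Term}, k ∈ G m → ∀ {p : List Bool}, p.length + m = n →
    dst g p = k → path g (descend k p) = path g p
  | 0, k, hk, p, hp, h => by rw [mem_G_zero.1 hk]; rfl
  | 1, k, hk, p, hp, h => by
    rw [mem_G_one.1 hk] at h ⊢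
    rw [descend_gxx, path, h]
    change _ * (ganc .one * gen one) = _
    rw [mul_gen_one, mul_ganc_one]
  | m + 2, k, hk, p, hp, h => by
    obtain ⟨l, s, r, t, rfl, hl, hr, hc, hne⟩ := exists_join hk
    have hr' : dst g (true :: p) = r := by rw [dst, h]; rfl
    rw [descend_join hl hr hc, path_descend (child_mem hl s) (by simp; omega)
      (by rw [dst, hr', hc]), path, path, hr', h, ← hc, ← path_mul_gen hg hp, h]
    change path g p * gen (join l s r t) * (ganc (r.childAnchor t).inv.inv * gen r) *
      (ganc (r.childAnchor t).inv * gen (l.child s)) = _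
    rw [Anchor.inv_inv]
    simp only [mul_assoc]
    rw [sandwich_right hk]

theorem path_mul_step {k : Term} (hk : IsGen k) {p q : List Bool} (hp : p.length = n)
    (h : step g k p = some q) : path g p * gen k = path g q := by
  have hd := dst_eq_one hg hp
  rcases hk with ⟨a, rfl⟩ | ⟨m, -, hk⟩
  · rw [step_anchor hd] at h
    cases a with
    | one => cases h; exact mul_gen_one _
    | x =>
      obtain ⟨q, hq, rfl⟩ := Option.map_eq_some_iff.1 h
      have := path_mul_up hg (m := 0) (s := false) hp (mem_G_one.2 rfl) hd hq
      change _ * (ganc .one * _) = _ at this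
      rw [ganc_one_mul] at this
      rw [path, dst_up hq, ← this, ← ganc_eq]
      change _ = _ * (ganc .x * gen one)
      rw [mul_gen_one, mul_assoc, gen_gxx_mul_x]
    | x' =>
      obtain ⟨q, hq, rfl⟩ := Option.map_eq_some_iff.1 h
      have := path_mul_up hg (m := 0) (s := true) hp (mem_G_one.2 rfl) hd hq
      change _ * (ganc .x' * _) = _ at this
      rw [x'_mul_gen_gxx] at this
      rw [path, dst_up hq, ← this, ← ganc_eq]
      change _ = _ * (ganc .one * gen one)
      rw [mul_gen_one, mul_ganc_one]
  · rw [step_eq hk hd] at h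
    obtain ⟨q, hq, rfl⟩ := Option.map_eq_some_iff.1 h
    have := length_ascend hk hq
    rw [path_mul_ascend hg hk hp hq, path_descend hg hk (by omega) (dst_ascend hk hd hq)]

omit hg in
theorem act_gen {k : Term} (hk : IsGen k) (o : Option (List Bool)) :
    act g (gen k) o = o.bind (step g k) := by
  rw [gen, dif_pos hk]; rfl

omit hg in
theorem act_none (a : F1) : act g a none = none := by
  obtain ⟨w, rfl⟩ := exists_mk a
  exact run_none w

theorem path_mul_of_act {a : F1} {p q : List Bool} (hp : p.length = n)
    (h : act g a (some p) = some q) : path g p * a = path g q ∧ q.length = n := by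
  induction a using gen_induction generalizing p with
  | h1 k hk =>
    rw [act_gen hk] at h
    exact ⟨path_mul_step hg hk hp h, (length_step hk h).symm.trans hp⟩
  | h2 k a hk ih =>
    rw [act_mul, act_gen hk, Option.bind_some] at h
    cases h' : step g k p with
    | none => rw [h', act_none] at h; cases h
    | some p' =>
      rw [h'] at h
      rw [← mul_assoc, path_mul_step hg hk hp h']
      exact ih ((length_step hk h').symm.trans hp) h

theorem length_descend_nil : (descend g []).length = n := by
  rw [length_descend hg, List.length_nil, zero_add]

theorem path_descend_nil : path g (descend g []) = gen g :=
  path_descend hg hg (by simp) rfl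

/-- The ascent to `g` uses up all `n` descents, leaving the empty path, so the outcome does not
depend on `p`. -/
theorem act_self {p q : List Bool} (h : act g (gen g) (some p) = some q) (hp : p.length = n) :
    q = descend g [] := by
  rw [act_gen (isGen_of_mem hg), Option.bind_some, step_eq hg (dst_eq_one hg hp)] at h
  obtain ⟨q, hq, rfl⟩ := Option.map_eq_some_iff.1 h
  have := length_ascend hg hq
  rw [List.length_eq_zero_iff.1 (show q.length = 0 by omega)]

theorem act_self_descend_nil : act g (gen g) (some (descend g [])) = some (descend g []) := by
  rw [act_gen (isGen_of_mem hg), Option.bind_some, step_eq hg (dst_descend hg rfl),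
    ascend_descend hg rfl, Option.map_some]

/-- Started at the canonical path of `g`, the element of `p` leads to `p` continued canonically to
`1`; for a full path this is `p` itself, so `path g` is injective there. -/
theorem act_path {p : List Bool} {m : ℕ} (h : p.length + m = n) :
    act g (path g p) (some (descend g [])) = some (descend (dst g p) p) := by
  induction p generalizing m with
  | nil => exact act_self_descend_nil hg
  | cons s p ih =>
    have hm : p.length + (m + 1) = n := by rw [← h, List.length_cons]; omega
    have hu := dst_mem hg hm
    rw [path, act_mul, ih hm, act_mul, ganc_eq, act_gen (Or.inl ⟨_, rfl⟩),
      act_gen (isGen_of_mem (child_mem hu s))]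
    exact bind_step_descent hu s (o := some p) fun q hq => by cases hq; rfl

theorem act_path_full {p : List Bool} (h : p.length = n) :
    act g (path g p) (some (descend g [])) = some p := by
  rw [act_path hg (m := 0) h, dst_eq_one hg h]; rfl

theorem path_injOn : Set.InjOn (path g) {p | p.length = n} := by
  intro p hp q hq h
  have := act_path_full hg hp
  rw [h, act_path_full hg hq] at this
  exact (Option.some_injective _ this).symm

end

end WeakGen

namespace WeakGen
open Term

/-! ### The involution of `F¹` -/

theorem isGen_star {t : Term} (h : IsGen t) : IsGen t.star := by
  rcases h with ⟨a, rfl⟩ | ⟨i, hi, h⟩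
  · exact Or.inl ⟨a.inv, rfl⟩
  · exact Or.inr ⟨i, hi, (star_star_mem h).1⟩

theorem star_star {t : Term} (h : IsGen t) : t.star.star = t := by
  rcases h with ⟨a, rfl⟩ | ⟨i, hi, h⟩
  · simp only [Term.star, Anchor.inv_inv]
  · exact (star_star_mem h).2

/-- The anti-homomorphism from words to `F¹` that dualizes every letter. -/
noncomputable def starHom : Word →ₙ* F1ᵐᵒᵖ :=
  FreeSemigroup.lift fun k => MulOpposite.op (gen k.1.star)

/-- The reversed dual of a word. -/
noncomputable def starWord (w : Word) : F1 := (starHom w).unop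

theorem starWord_letter (k : Gen) : starWord (letter k) = gen k.1.star := rfl

theorem starWord_anc (a : Anchor) : starWord (anc a) = ganc a.inv := (ganc_eq a.inv).symm

theorem starWord_mul (v w : Word) : starWord (v * w) = starWord w * starWord v := by
  rw [starWord, map_mul]; rfl

theorem starWord_rel {v w : Word} (h : Rel v w) : starWord v = starWord w := by
  cases h with
  | x_reg =>
    simp only [starWord_mul, starWord_anc, ← mul_assoc]
    exact mk_rel Rel.x'_reg
  | x'_reg =>
    simp only [starWord_mul, starWord_anc, ← mul_assoc]
    exact mk_rel Rel.x_reg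
  | gxx_eq =>
    simp only [starWord_mul, starWord_anc, starWord_letter]
    change gen gxx.star = ganc .x * ganc .x'
    rw [star_gxx, gen_gxx]
  | one_left k =>
    simp only [starWord_mul, starWord_anc]
    exact mul_ganc_one _
  | one_right k =>
    simp only [starWord_mul, starWord_anc]
    exact ganc_one_mul _
  | idem i k hk =>
    simp only [starWord_mul, starWord_letter]
    exact gen_mul_self (star_star_mem hk).1
  | sandwich_left i hi k hk =>
    obtain ⟨i, rfl⟩ := Nat.exists_eq_add_of_le' hi
    obtain ⟨l, s, r, t, hu, hl, hr, hc, hne⟩ := exists_join hk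
    obtain ⟨k, hgen⟩ := k
    dsimp only at hu hk
    subst hu
    obtain ⟨s', t', hj, hs1, hs2, ht1, ht2⟩ := exists_star_join hl hr hc
    have h := sandwich_right (hj ▸ (star_star_mem hk).1)
    simp only [starWord_mul, wordL, starWord_letter, starWord_anc]
    change gen (join l s r t).star * (ganc (l.childAnchor s).inv.inv * (gen l.star *
      ganc (l.childAnchor s).inv.inv.inv) * gen (l.child s).star) = gen (join l s r t).star
    rw [Anchor.inv_inv, hj]
    simp only [mul_assoc]
    rwa [hs2, ht1] at h
  | sandwich_right i hi k hk =>
    obtain ⟨i, rfl⟩ := Nat.exists_eq_add_of_le' hi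
    obtain ⟨l, s, r, t, hu, hl, hr, hc, hne⟩ := exists_join hk
    obtain ⟨k, hgen⟩ := k
    dsimp only at hu hk
    subst hu
    obtain ⟨s', t', hj, hs1, hs2, ht1, ht2⟩ := exists_star_join hl hr hc
    have h := sandwich_left (hj ▸ (star_star_mem hk).1)
    simp only [starWord_mul, wordR, starWord_letter, starWord_anc]
    change gen (l.child s).star * ((ganc (r.childAnchor t).inv.inv * (gen r.star *
      ganc (r.childAnchor t).inv.inv.inv)) * gen (join l s r t).star) = gen (join l s r t).star
    rw [Anchor.inv_inv, hj]
    simp only [mul_assoc]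
    rwa [ht2, ht1] at h
  | sandwich_mid i hi k hk =>
    obtain ⟨i, rfl⟩ := Nat.exists_eq_add_of_le' hi
    obtain ⟨l, s, r, t, hu, hl, hr, hc, hne⟩ := exists_join hk
    obtain ⟨k, hgen⟩ := k
    dsimp only at hu hk
    subst hu
    obtain ⟨s', t', hj, hs1, hs2, ht1, ht2⟩ := exists_star_join hl hr hc
    have h := sandwich_mid (hj ▸ (star_star_mem hk).1)
    simp only [starWord_mul, starWord_letter, starWord_anc]
    change gen l.star * (ganc (l.childAnchor s).inv.inv.inv * (gen (join l s r t).star *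
      (ganc (r.childAnchor t).inv.inv * gen r.star))) =
      gen l.star * (ganc (l.childAnchor s).inv.inv.inv * (gen (l.child s).star *
      (ganc (r.childAnchor t).inv.inv * gen r.star)))
    rw [Anchor.inv_inv, Anchor.inv_inv, hj]
    rwa [hs2, ht2, ht1] at h

theorem starWord_congr {v w : Word} (h : conGen Rel v w) : starWord v = starWord w := by
  have : conGen Rel ≤ Con.ker starHom :=
    Con.conGen_le.2 fun v w h => MulOpposite.unop_injective (starWord_rel h)
  exact congrArg MulOpposite.unop (this h)

/-- The involution of `F¹`. -/
noncomputable def dual (a : F1) : F1 := Con.liftOn a starWord fun _ _ h => starWord_congr h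

theorem dual_gen {k : Term} (hk : IsGen k) : dual (gen k) = gen k.star := by
  rw [gen_eq hk]; rfl

theorem dual_mul (a b : F1) : dual (a * b) = dual b * dual a := by
  obtain ⟨v, rfl⟩ := exists_mk a
  obtain ⟨w, rfl⟩ := exists_mk b
  exact starWord_mul v w

theorem dual_dual (a : F1) : dual (dual a) = a := by
  induction a using gen_induction with
  | h1 k hk => rw [dual_gen hk, dual_gen (isGen_star hk), star_star hk]
  | h2 k a hk h =>
    rw [dual_mul, dual_mul, h, dual_gen hk, dual_gen (isGen_star hk), star_star hk]

open Green

theorem R_dual {a b : F1} (h : L F1 a b) : R F1 (dual a) (dual b) := by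
  obtain ⟨⟨u, hu⟩, v, hv⟩ := (L_iff ganc_one_mul).1 h
  exact (R_iff mul_ganc_one).2
    ⟨⟨dual u, by rw [← dual_mul, ← hu]⟩, dual v, by rw [← dual_mul, ← hv]⟩

theorem L_dual {a b : F1} (h : R F1 a b) : L F1 (dual a) (dual b) := by
  obtain ⟨⟨u, hu⟩, v, hv⟩ := (R_iff mul_ganc_one).1 h
  exact (L_iff ganc_one_mul).2
    ⟨⟨dual u, by rw [← dual_mul, ← hu]⟩, dual v, by rw [← dual_mul, ← hv]⟩

/-- The involution exchanges `𝓛` and `𝓡` and sends `[g]` to the class of a generator of the same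
height, so the count for `𝓡` carries over. -/
theorem cls_L_eq (a : F1) : cls (L F1) a = dual '' cls (R F1) (dual a) := by
  ext b
  constructor
  · exact fun h => ⟨dual b, R_dual h, dual_dual b⟩
  · rintro ⟨c, hc, rfl⟩
    have := L_dual hc
    rwa [dual_dual] at this

/-! ### The `𝓡`-class of a generator -/

section

variable {g : Term} {n : ℕ} (hg : g ∈ G n)

include hg

theorem exists_path_of_R {a : F1} (h : R F1 (gen g) a) :
    ∃ p : List Bool, p.length = n ∧ a = path g p := by
  obtain ⟨⟨v, hv⟩, u, rfl⟩ := (R_iff mul_ganc_one).1 h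
  have h0 := act_self_descend_nil hg
  cases hu : act g u (some (descend g [])) with
  | none =>
    -- Zero is absorbing: if `u` killed the canonical path, so would `[g] = [g]uv`, which fixes it.
    have h1 : act g (gen g) (some (descend g [])) = none := by
      rw [hv, act_mul, act_mul, h0, hu, act_none]
    rw [h0] at h1
    cases h1
  | some q =>
    obtain ⟨h1, h2⟩ := path_mul_of_act hg (length_descend_nil hg) hu
    exact ⟨q, h2, by rw [← h1, path_descend_nil hg]⟩

theorem R_path {p : List Bool} {m : ℕ} (h : p.length + m = n) : R F1 (gen g) (path g p) := by
  induction p generalizing m with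
  | nil => exact (R F1).refl' _
  | cons s p ih =>
    have hm : p.length + (m + 1) = n := by rw [← h, List.length_cons]; omega
    exact (R F1).trans' (ih hm) ((R_iff mul_ganc_one).2
      ⟨⟨_, (path_cons_mul hg hm s).symm⟩, _, rfl⟩)

theorem cls_R_gen : cls (R F1) (gen g) = path g '' {p | p.length = n} := by
  ext a
  rw [mem_cls]
  constructor
  · intro h
    obtain ⟨p, hp, rfl⟩ := exists_path_of_R hg h
    exact ⟨p, hp, rfl⟩
  · rintro ⟨p, hp, rfl⟩
    exact R_path hg (m := 0) hp

theorem ncard_cls_R_gen : (cls (R F1) (gen g)).ncard = 2 ^ n := by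
  rw [cls_R_gen hg, (path_injOn hg).ncard_image]
  -- The lists of length `n`, as a subtype, are `List.Vector Bool n` by definition.
  change Nat.card (List.Vector Bool n) = _
  rw [Nat.card_eq_fintype_card, card_vector, Fintype.card_bool]

theorem ncard_cls_L_gen : (cls (L F1) (gen g)).ncard = 2 ^ n := by
  rw [cls_L_eq, Set.ncard_image_of_injective _ (Function.LeftInverse.injective dual_dual),
    dual_gen (isGen_of_mem hg), ncard_cls_R_gen (star_star_mem hg).1]

theorem eq_gen_of_H {a : F1} (hR : R F1 (gen g) a) (hL : L F1 (gen g) a) : a = gen g := by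
  obtain ⟨p, hp, rfl⟩ := exists_path_of_R hg hR
  have h := act_path_full hg hp
  -- An element `𝓛`-related to the idempotent `[g]` absorbs it on the right, so `[g]` fixes `p`, and
  -- `act_self` identifies `p`.
  rw [← mul_eq_of_L (gen_mul_self hg) ganc_one_mul hL, act_mul, act_path_full hg hp] at h
  rw [act_self hg h hp, path_descend_nil hg]

end

end WeakGen
theorem mainTheorem7 (n : ℕ) (hn : 1 ≤ n) (t : WeakGen.Term) (ht : t ∈ WeakGen.G n) :
    let g : WeakGen.F1 := WeakGen.mk (WeakGen.letter (WeakGen.Gen.ofMem ht))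
    let DC : Set WeakGen.F1 := Green.cls (Green.D WeakGen.F1) g
    (Green.cls (Green.R WeakGen.F1) g).ncard = 2 ^ n ∧
    (Green.cls (Green.L WeakGen.F1) g).ncard = 2 ^ n ∧
    DC.ncard = 2 ^ (2 * n) ∧
    {C : Set WeakGen.F1 | C ⊆ DC ∧ ∃ b, C = Green.cls (Green.R WeakGen.F1) b}.ncard = 2 ^ n ∧
    {C : Set WeakGen.F1 | C ⊆ DC ∧ ∃ b, C = Green.cls (Green.L WeakGen.F1) b}.ncard = 2 ^ n := by
  intro g DC
  have hgen : g = WeakGen.gen t := WeakGen.mk_letter _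
  have hR := WeakGen.ncard_cls_R_gen ht
  have hL := WeakGen.ncard_cls_L_gen ht
  have hH := fun h => WeakGen.eq_gen_of_H (a := h) ht
  have he := WeakGen.gen_mul_self ht
  simp only [DC, hgen]
  refine ⟨hR, hL, ?_, ?_, ?_⟩
  · rw [Green.ncard_cls_D WeakGen.mul_ganc_one WeakGen.ganc_one_mul he hH, hR, hL]
    ring
  · rw [Green.ncard_R_classes WeakGen.mul_ganc_one WeakGen.ganc_one_mul he hH, hL]
  · rw [Green.ncard_L_classes WeakGen.mul_ganc_one WeakGen.ganc_one_mul he hH, hR]
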